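/- A \emph{max-min LP} consists of disjoint finite sets $V$ (agents), $I$ (constraints), $K$ (objectives), a graph $\mathcal G$ on $V\cup I\cup K$ each of whose edges joins an agent to an element of $I\cup K$, and coefficients $a_{iv}\ge 0$, $c_{kv}\ge 0$ on the edges $\{i,v\}$, $\{k,v\}$. With $V_j$ denoting the set of agents adjacent to $j\in I\cup K$, the task is to maximise $\min_{k\in K}\sum_{v\in V_k}c_{kv}x_v$ subject to $\sum_{v\in V_i}a_{iv}x_v\le 1$ for all $i\in I$ and $x_v\ge 0$ for all $v\in V$; its optimum is $\omega^*$. It is \emph{bipartite} if every agent is adjacent to exactly one constraint and exactly one objective. Let $B(s,r)$ be the set of vertices at distance at most $r$ from $s$ in $\mathcal G$; $\mathcal G$ has \emph{bounded relative growth} $1+\delta$ \emph{beyond radius} $R$ if $|V\cap B(v,r+2)|/|V\cap B(v,r)|\le 1+\delta$ for all $v\in V$ and all integers $r\ge R$. The nodes carry unique identifiers (natural numbers) and a port numbering (each node numbers its incident edges). The local input of an agent consists of its identifier, its adjacent constraints and objectives (identifiers and port numbers), and the coefficients on its edges; the local input of a constraint or an objective consists of its identifier and its adjacent agents (identifiers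 and port numbers). A \emph{local approximation algorithm} with local horizon $r\in\mathbb N$ and approximation ratio $\alpha\ge 1$ for a family of max-min LPs is a deterministic rule which determines each $x_v$ as a function of the identifier of $v$ and the local inputs of the nodes in $B(v,r)$ such that, for every member of the family and all identifiers and port numberings, $x$ is feasible and $\sum_{v\in V_k}c_{kv}x_v\ge\omega^*/\alpha$ for all $k\in K$; the rule, $r$ and $\alpha$ do not depend on the member. \textbf{Theorem.} Let $\Delta_I\ge 3$ and $\Delta_K\ge 3$ be integers and let $0<\delta<1/10$. There is no local approximation algorithm with an approximation ratio $\alpha<1+\delta/2$ for the max-min LPs with $|V_i|\le\Delta_I$ for all $i\in I$ and $|V_k|\le\Delta_K$ for all $k\in K$. Moreover, there is a constant $R\in\mathbb N$ such that no such algorithm exists even for the subfamily of those max-min LPs that are bipartite, have only strictly positive coefficients, and whose graph $\mathcal G$ has bounded relative growth $1+\delta$ beyond radius $R$. -/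

import Mathlib

/-- A finite max-min linear program together with its communication graph.
`V` are the agents, `I` the constraints, `K` the objectives; `conEdge i v` says that
`{v, i}` is an edge and `objEdge k v` that `{v, k}` is an edge.  The coefficients `a i v`, `c k v`
are only meaningful (and only used) on edges. -/
structure MaxMinLP where
  V : Type
  I : Type
  K : Type
  [fintypeV : Fintype V]
  [fintypeI : Fintype I]
  [fintypeK : Fintype K]
  conEdge : I → V → Prop
  objEdge : K → V → Prop
  a : I → V → ℝ
  c : K → V → ℝ
  a_nonneg : ∀ i v, conEdge i v → 0 ≤ a i v
  c_nonneg : ∀ k v, objEdge k v → 0 ≤ c k v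

attribute [instance] MaxMinLP.fintypeV MaxMinLP.fintypeI MaxMinLP.fintypeK

namespace MaxMinLP

noncomputable section

/-- The vertices of the communication graph: the disjoint union of `V`, `I` and `K`. -/
inductive Node (L : MaxMinLP) : Type
  | agent (v : L.V) : Node L
  | con (i : L.I) : Node L
  | obj (k : L.K) : Node L

/-- The communication graph. -/
def graph (L : MaxMinLP) : SimpleGraph L.Node where
  Adj s t :=
    match s, t with
    | .agent v, .con i => L.conEdge i v
    | .con i, .agent v => L.conEdge i v
    | .agent v, .obj k => L.objEdge k v
    | .obj k, .agent v => L.objEdge k v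
    | _, _ => False
  symm := ⟨by
    intro s t h
    cases s <;> cases t <;> exact h⟩
  loopless := ⟨by
    intro s h
    cases s <;> exact h⟩

/-- The ball `B(s, r)`: the vertices within distance at most `r` from `s`
(`edist` is `⊤` between different connected components). -/
def ball (L : MaxMinLP) (s : L.Node) (r : ℕ) : Set L.Node :=
  {t | L.graph.edist s t ≤ (r : ℕ∞)}

open Classical in
/-- `V_i`: the agents adjacent to a constraint `i`. -/
def conAgents (L : MaxMinLP) (i : L.I) : Finset L.V :=
  Finset.univ.filter fun v => L.conEdge i v

open Classical in
/-- `V_k`: the agents adjacent to an objective `k`. -/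
def objAgents (L : MaxMinLP) (k : L.K) : Finset L.V :=
  Finset.univ.filter fun v => L.objEdge k v

/-- The value of the constraint `i` at `x`. -/
def conValue (L : MaxMinLP) (x : L.V → ℝ) (i : L.I) : ℝ :=
  ∑ v ∈ L.conAgents i, L.a i v * x v

/-- The value of the objective `k` at `x`. -/
def objValue (L : MaxMinLP) (x : L.V → ℝ) (k : L.K) : ℝ :=
  ∑ v ∈ L.objAgents k, L.c k v * x v

/-- Feasible solutions. -/
def Feasible (L : MaxMinLP) (x : L.V → ℝ) : Prop :=
  (∀ i, L.conValue x i ≤ 1) ∧ ∀ v, 0 ≤ x v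

/-- The utility of `x`, the minimum of the objectives (`⊤` if there are no objectives). -/
def utility (L : MaxMinLP) (x : L.V → ℝ) : EReal :=
  ⨅ k, (L.objValue x k : EReal)

/-- The optimum of the max-min LP (`⊤` if the utility is unbounded). -/
def opt (L : MaxMinLP) : EReal :=
  ⨆ x ∈ {x | L.Feasible x}, L.utility x

/-- The degree bounds `|V_i| ≤ ΔI` and `|V_k| ≤ ΔK`. -/
def DegreeBounded (L : MaxMinLP) (ΔI ΔK : ℕ) : Prop :=
  (∀ i, (L.conAgents i).card ≤ ΔI) ∧ ∀ k, (L.objAgents k).card ≤ ΔK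

/-- The bipartite version: each agent is adjacent to exactly one constraint and exactly one
objective. -/
def IsBipartite (L : MaxMinLP) : Prop :=
  ∀ v, (∃! i, L.conEdge i v) ∧ ∃! k, L.objEdge k v

/-- All coefficients on the edges are strictly positive. -/
def PositiveCoefficients (L : MaxMinLP) : Prop :=
  (∀ i v, L.conEdge i v → 0 < L.a i v) ∧ ∀ k v, L.objEdge k v → 0 < L.c k v

/-- The number `|V ∩ B(v, r)|` of agents within distance `r` from the agent `v`. -/
def ballAgentCount (L : MaxMinLP) (v : L.V) (r : ℕ) : ℕ :=
  {u : L.V | Node.agent u ∈ L.ball (Node.agent v) r}.ncard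

/-- Bounded relative growth `1 + δ` beyond radius `R`. -/
def BoundedRelativeGrowth (L : MaxMinLP) (δ : ℝ) (R : ℕ) : Prop :=
  ∀ (v : L.V) (r : ℕ), R ≤ r →
    (L.ballAgentCount v (r + 2) : ℝ) / (L.ballAgentCount v r : ℝ) ≤ 1 + δ

/-- The symmetry-breaking information of a network: unique identifiers and a port numbering.
`port s t` is the number that `s` gives to its edge `{s, t}`; the edges incident to `s` get
distinct numbers `0, …, deg s - 1` (values off the edges are never used). -/
structure Labelling (L : MaxMinLP) where
  ident : L.Node → ℕ
  ident_injective : Function.Injective ident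
  port : L.Node → L.Node → ℕ
  port_lt : ∀ s t, L.graph.Adj s t → port s t < (L.graph.neighborSet s).ncard
  port_injOn : ∀ s, Set.InjOn (port s) (L.graph.neighborSet s)

/-- What a single node is given as input.  An agent gets its adjacent constraints and its adjacent
objectives, as triples (identifier, port, coefficient); a constraint or an objective gets its
adjacent agents, as pairs (identifier, port). -/
inductive LocalInput : Type
  | agent (cons objs : Set (ℕ × ℕ × ℝ)) : LocalInput
  | con (agents : Set (ℕ × ℕ)) : LocalInput
  | obj (agents : Set (ℕ × ℕ)) : LocalInput

/-- The local input of a node. -/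
def Labelling.localInput {L : MaxMinLP} (N : L.Labelling) : L.Node → LocalInput
  | .agent v => .agent
      {p | ∃ i, L.conEdge i v ∧ p = (N.ident (.con i), N.port (.agent v) (.con i), L.a i v)}
      {p | ∃ k, L.objEdge k v ∧ p = (N.ident (.obj k), N.port (.agent v) (.obj k), L.c k v)}
  | .con i => .con
      {p | ∃ v, L.conEdge i v ∧ p = (N.ident (.agent v), N.port (.con i) (.agent v))}
  | .obj k => .obj
      {p | ∃ v, L.objEdge k v ∧ p = (N.ident (.agent v), N.port (.obj k) (.agent v))}

/-- All that the agent `v` can learn with local horizon `r`: the local inputs of the nodes in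
`B(v, r)`, tagged with the identifiers of these nodes. -/
def Labelling.view {L : MaxMinLP} (N : L.Labelling) (v : L.V) (r : ℕ) : Set (ℕ × LocalInput) :=
  (fun t => (N.ident t, N.localInput t)) '' L.ball (.agent v) r

/-- A deterministic rule that determines an agent's output from its own identifier and its view. -/
abbrev LocalRule : Type := ℕ → Set (ℕ × LocalInput) → ℝ

/-- The output of the rule `A`, run with local horizon `r`. -/
def Labelling.output {L : MaxMinLP} (N : L.Labelling) (A : LocalRule) (r : ℕ) : L.V → ℝ :=
  fun v => A (N.ident (.agent v)) (N.view v r)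

/-- The rule `A` with local horizon `r` is a local approximation algorithm with approximation
ratio `α` for the family `F` of max-min LPs: on each member of the family, for every choice of
identifiers and port numbers, the output is feasible and each objective is at least `opt / α`. -/
def IsLocalApproximation (A : LocalRule) (r : ℕ) (α : ℝ) (F : Set MaxMinLP) : Prop :=
  1 ≤ α ∧ ∀ L ∈ F, ∀ N : L.Labelling,
    L.Feasible (N.output A r) ∧
      ∀ k, L.opt / (α : EReal) ≤ (L.objValue (N.output A r) k : EReal)

end

end MaxMinLP

/-!
Let `𝒢` be a `d`-regular multigraph in which small neighbourhoods are trees, and replace each of its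
edges by a path of `2n + 2` agents, whose objectives are pairs of consecutive agents; the
constraints are the vertices of `𝒢` and the remaining pairs of consecutive agents. There are
`|E| (n + 1)` objectives and `|E| (n + 2 / d)` constraints. As the sum of the objectives equals the
sum of the constraints, each feasible solution has an objective of value at most
`(dn + 2) / (dn + d)`. The agents of this objective see a tree only. In the LP given by that tree
alone, orient all edges away from a root: the solution that is alternately `1` and `0` along each
path, with the `1` at the far end, has all objectives equal to `1`. A local algorithm gives the same
output for both LPs, so its approximation ratio is at least `(dn + d) / (dn + 2)`.

The relative growth of a subdivision is about `1 + (d - 2) / (2n + 2)`: a ball grows only at the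
fronts that move along the paths, and all but boundedly many of the branch vertices that feed these
fronts have been reached along a path of their own that lies in the ball. With `d = 3` the growth
is `1 + 1 / (2n + 2)`, while the ratio is `1 + 1 / (3n + 2)`.
-/

section Reach

variable {X : Type*} (R : X → X → Prop)

/-- The points that are reached from `x` by `t` steps along the relation `R`. It is used with
reflexive relations, for which it is the ball of radius `t` around `x`. -/
def reach (x : X) : ℕ → Set X
  | 0 => {x}
  | t + 1 => {z | ∃ y ∈ reach x t, R y z}

variable {R} {x : X}

theorem reach_mono [Std.Refl R] : Monotone (reach R x) :=
  monotone_nat_of_le_succ fun _ y hy => ⟨y, hy, Std.Refl.refl y⟩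

theorem mem_reach_self [Std.Refl R] (t : ℕ) : x ∈ reach R x t :=
  reach_mono t.zero_le rfl

theorem lt_ncard_reach [Std.Refl R] [Finite X] {t : ℕ} (h : reach R x (t + 1) ≠ reach R x t) :
    t < (reach R x t).ncard := by
  induction t with
  | zero => simp [reach]
  | succ t ih =>
    have hne : reach R x (t + 1) ≠ reach R x t := by
      contrapose! h
      change {z | ∃ y ∈ reach R x (t + 1), R y z} = {z | ∃ y ∈ reach R x t, R y z}
      rw [h]
    exact (Nat.succ_le_of_lt (ih hne)).trans_lt
      (Set.ncard_lt_ncard ((reach_mono t.le_succ).ssubset_of_ne hne.symm) (Set.toFinite _))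

end Reach

namespace MaxMinLP

theorem mem_conAgents {L : MaxMinLP} {i : L.I} {v : L.V} : v ∈ L.conAgents i ↔ L.conEdge i v := by
  simp only [conAgents, Finset.mem_filter, Finset.mem_univ, true_and]

theorem mem_objAgents {L : MaxMinLP} {k : L.K} {v : L.V} : v ∈ L.objAgents k ↔ L.objEdge k v := by
  simp only [objAgents, Finset.mem_filter, Finset.mem_univ, true_and]

/-! ### Balls -/

section Balls

variable {L : MaxMinLP}

theorem mem_ball_zero {s t : L.Node} : t ∈ L.ball s 0 ↔ s = t := by
  simp only [ball, Set.mem_ofPred_eq, Nat.cast_zero, nonpos_iff_eq_zero,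
    SimpleGraph.edist_eq_zero_iff]

theorem ball_mono (s : L.Node) : Monotone (L.ball s) :=
  fun _ _ h _ (ht : L.graph.edist _ _ ≤ _) => ht.trans (Nat.cast_le.2 h)

theorem mem_ball_succ {s t : L.Node} {n : ℕ} :
    t ∈ L.ball s (n + 1) ↔ ∃ u ∈ L.ball s n, u = t ∨ L.graph.Adj u t := by
  constructor
  · intro h
    obtain ⟨w, hw⟩ := SimpleGraph.exists_walk_of_edist_ne_top (ne_top_of_le_ne_top (by simp) h)
    have hlen : w.length ≤ n + 1 := Nat.cast_le.1 (hw.trans_le h)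
    by_cases hnil : w.Nil
    · exact ⟨t, by simp [ball, hnil.eq], Or.inl rfl⟩
    · have hdrop : w.dropLast.length ≤ n := by
        have := w.length_dropLast_add_one hnil
        lia
      exact ⟨w.penultimate, w.dropLast.edist_le.trans (Nat.cast_le.2 hdrop),
        Or.inr (w.adj_penultimate hnil)⟩
  · rintro ⟨u, hu, rfl | hadj⟩
    · exact ball_mono s n.le_succ hu
    · refine (SimpleGraph.edist_triangle (v := u)).trans ?_
      rw [SimpleGraph.edist_eq_one_iff_adj.2 hadj, Nat.cast_succ]
      exact add_le_add_left hu 1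

theorem ball_add_subset_ball_add {s t : L.Node} {m n : ℕ} (hst : t ∈ L.ball s m) :
    L.ball t n ⊆ L.ball s (m + n) := by
  intro u hu
  refine (SimpleGraph.edist_triangle (v := t)).trans ?_
  rw [Nat.cast_add]
  exact add_le_add hst hu

variable (L) in
/-- Two agents are linked if they are equal or have a common neighbour, that is, if their distance
is at most two. -/
def Linked (p q : L.V) : Prop :=
  p = q ∨ ∃ s, L.graph.Adj (.agent p) s ∧ L.graph.Adj s (.agent q)

instance : Std.Refl L.Linked := ⟨fun _ => Or.inl rfl⟩

theorem exists_agent_of_adj_of_adj {s t : L.Node} {v : L.V} (hst : L.graph.Adj s t)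
    (htv : L.graph.Adj t (.agent v)) : ∃ p, s = .agent p := by
  cases t with
  | agent => exact htv.elim
  | con | obj =>
    cases s with
    | agent p => exact ⟨p, rfl⟩
    | con | obj => exact hst.elim

theorem agent_mem_ball_one_iff {v u : L.V} : Node.agent u ∈ L.ball (.agent v) 1 ↔ v = u := by
  refine ⟨fun h => ?_, ?_⟩
  · obtain ⟨s, hs, hsu⟩ := mem_ball_succ.1 h
    obtain rfl := mem_ball_zero.1 hs
    obtain hvu | hvu := hsu
    · exact Node.agent.inj hvu
    · exact hvu.elim
  · rintro rfl
    exact ball_mono _ zero_le_one (mem_ball_zero.2 rfl)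

theorem exists_linked_of_agent_mem_ball {v u : L.V} {r : ℕ}
    (h : Node.agent u ∈ L.ball (.agent v) (r + 1)) :
    ∃ p, Node.agent p ∈ L.ball (.agent v) (r - 1) ∧ L.Linked p u := by
  induction r with
  | zero =>
    exact ⟨v, mem_ball_zero.2 rfl, Or.inl (agent_mem_ball_one_iff.1 h)⟩
  | succ r ih =>
    by_cases hu : Node.agent u ∈ L.ball (.agent v) (r + 1)
    · obtain ⟨p, hp, hpu⟩ := ih hu
      exact ⟨p, ball_mono _ (Nat.sub_le r 1) hp, hpu⟩
    obtain ⟨s, hs, rfl | hsu⟩ := mem_ball_succ.1 h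
    · exact absurd hs hu
    obtain ⟨s', hs', rfl | hadj⟩ := mem_ball_succ.1 hs
    · exact absurd (mem_ball_succ.2 ⟨_, hs', Or.inr hsu⟩) hu
    · obtain ⟨p, rfl⟩ := exists_agent_of_adj_of_adj hadj hsu
      exact ⟨p, hs', Or.inr ⟨s, hadj, hsu⟩⟩

theorem agent_mem_ball_iff {v u : L.V} {r : ℕ} :
    Node.agent u ∈ L.ball (.agent v) r ↔ u ∈ reach L.Linked v (r / 2) := by
  induction r using Nat.twoStepInduction generalizing u with
  | zero => rw [mem_ball_zero, Node.agent.injEq, eq_comm]; rfl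
  | one => rw [agent_mem_ball_one_iff, eq_comm]; rfl
  | more r ih _ =>
    rw [Nat.add_div_right r two_pos]
    refine ⟨fun h => ?_, ?_⟩
    · obtain ⟨p, hp, hpu⟩ := exists_linked_of_agent_mem_ball h
      exact ⟨p, ih.1 hp, hpu⟩
    · rintro ⟨p, hp, rfl | ⟨s, hps, hsu⟩⟩
      · exact ball_mono _ (Nat.le_add_right r 2) (ih.2 hp)
      · exact mem_ball_succ.2 ⟨s, mem_ball_succ.2 ⟨_, ih.2 hp, Or.inr hps⟩, Or.inr hsu⟩

theorem ballAgentCount_eq_ncard_reach (v : L.V) (r : ℕ) :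
    L.ballAgentCount v r = (reach L.Linked v (r / 2)).ncard := by
  simp only [ballAgentCount, agent_mem_ball_iff, Set.ofPred_mem_eq]

theorem exists_agent_mem_ball {v : L.V} {s : L.Node} {r : ℕ} (h : s ∈ L.ball (.agent v) r) :
    ∃ q, .agent q ∈ L.ball (.agent v) r ∧ (.agent q = s ∨ L.graph.Adj (.agent q) s) := by
  induction r generalizing s with
  | zero => exact ⟨v, mem_ball_zero.2 rfl, Or.inl (mem_ball_zero.1 h)⟩
  | succ r ih =>
    cases s with
    | agent q => exact ⟨q, h, Or.inl rfl⟩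
    | con | obj =>
      obtain ⟨u, hu, rfl | hus⟩ := mem_ball_succ.1 h
      · obtain ⟨q, hq, hqs⟩ := ih hu
        exact ⟨q, ball_mono _ r.le_succ hq, hqs⟩
      · cases u with
        | agent q => exact ⟨q, ball_mono _ r.le_succ hu, Or.inr hus⟩
        | con | obj => exact hus.elim

end Balls

/-! ### Local rules and embeddings -/

instance (L : MaxMinLP) : Finite L.Node :=
  Finite.of_injective
    (fun t : L.Node => match t with
      | .agent v => (Sum.inl v : L.V ⊕ L.I ⊕ L.K)
      | .con i => .inr (.inl i)
      | .obj k => .inr (.inr k))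
    (by rintro (_ | _ | _) (_ | _ | _) <;> simp)

section OfIdent

variable {L : MaxMinLP} (ident : L.Node ↪ ℕ)

/-- The number of neighbours of `s` whose identifiers are smaller than that of `t`. -/
noncomputable def rank (s t : L.Node) : ℕ :=
  {u | L.graph.Adj s u ∧ ident u < ident t}.ncard

variable {ident} in
theorem rank_lt_rank {s t u : L.Node} (hst : L.graph.Adj s t) (htu : ident t < ident u) :
    rank ident s t < rank ident s u :=
  Set.ncard_lt_ncard
    ⟨fun _ hw => ⟨hw.1, hw.2.trans htu⟩, fun hsub => (hsub (a := t) ⟨hst, htu⟩).2.false⟩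

/-- The labelling in which every node numbers its neighbours by increasing identifiers. Its ports
are thus determined by its identifiers. -/
noncomputable def Labelling.ofIdent : L.Labelling where
  ident := ident
  ident_injective := ident.injective
  port := rank ident
  port_lt _ t hst := Set.ncard_lt_ncard ⟨fun _ hu => hu.1, fun hsub => (hsub (a := t) hst).2.false⟩
  port_injOn _ t hst u hsu heq := by
    rcases lt_trichotomy (ident t) (ident u) with h | h | h
    · exact absurd heq (rank_lt_rank hst h).ne
    · exact ident.injective h
    · exact absurd heq (rank_lt_rank hsu h).ne'

end OfIdent

theorem setOf_exists_eq_congr {X Y Z : Type*} {P : X → Prop} {Q : Y → Prop} {f : X → Z} {g : Y → Z}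
    {e : X → Y} (hQ : ∀ {x}, Q (e x) ↔ P x) (hrange : ∀ y, Q y → y ∈ Set.range e)
    (hfg : ∀ x, f x = g (e x)) : {z | ∃ x, P x ∧ z = f x} = {z | ∃ y, Q y ∧ z = g y} := by
  ext z
  constructor
  · rintro ⟨x, hx, rfl⟩
    exact ⟨e x, hQ.2 hx, hfg x⟩
  · rintro ⟨y, hy, rfl⟩
    obtain ⟨x, rfl⟩ := hrange y hy
    exact ⟨x, hQ.1 hy, (hfg x).symm⟩

/-- An embedding of max-min LPs: an isomorphism of `L'` onto the sub-LP of `L` that is induced by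
the image. -/
structure Embedding (L' L : MaxMinLP) where
  onV : L'.V ↪ L.V
  onI : L'.I ↪ L.I
  onK : L'.K ↪ L.K
  conEdge_iff : ∀ {i v}, L.conEdge (onI i) (onV v) ↔ L'.conEdge i v
  objEdge_iff : ∀ {k v}, L.objEdge (onK k) (onV v) ↔ L'.objEdge k v
  a_eq : ∀ i v, L.a (onI i) (onV v) = L'.a i v
  c_eq : ∀ k v, L.c (onK k) (onV v) = L'.c k v

namespace Embedding

variable {L' L : MaxMinLP} (φ : Embedding L' L)

/-- The action of an embedding on the nodes of the communication graph. -/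
def onNode : L'.Node ↪ L.Node where
  toFun
    | .agent v => .agent (φ.onV v)
    | .con i => .con (φ.onI i)
    | .obj k => .obj (φ.onK k)
  inj' := by rintro (_ | _ | _) (_ | _ | _) <;> simp

theorem onNode_agent (v : L'.V) : φ.onNode (.agent v) = .agent (φ.onV v) := rfl

theorem agent_mem_range_iff {v : L.V} :
    .agent v ∈ Set.range φ.onNode ↔ v ∈ Set.range φ.onV := by
  constructor
  · rintro ⟨v | _ | _, h⟩
    exacts [⟨v, Node.agent.inj h⟩, (nomatch h), (nomatch h)]
  · rintro ⟨v, rfl⟩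
    exact ⟨.agent v, rfl⟩

theorem con_mem_range_iff {i : L.I} : .con i ∈ Set.range φ.onNode ↔ i ∈ Set.range φ.onI := by
  constructor
  · rintro ⟨_ | i | _, h⟩
    exacts [(nomatch h), ⟨i, Node.con.inj h⟩, (nomatch h)]
  · rintro ⟨i, rfl⟩
    exact ⟨.con i, rfl⟩

theorem obj_mem_range_iff {k : L.K} : .obj k ∈ Set.range φ.onNode ↔ k ∈ Set.range φ.onK := by
  constructor
  · rintro ⟨_ | _ | k, h⟩
    exacts [(nomatch h), (nomatch h), ⟨k, Node.obj.inj h⟩]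
  · rintro ⟨k, rfl⟩
    exact ⟨.obj k, rfl⟩

theorem adj_iff {s t : L'.Node} : L.graph.Adj (φ.onNode s) (φ.onNode t) ↔ L'.graph.Adj s t := by
  cases s <;> cases t <;> first | exact φ.conEdge_iff | exact φ.objEdge_iff | exact Iff.rfl

theorem mem_ball_of_mem_ball {s t : L'.Node} {n : ℕ} (h : t ∈ L'.ball s n) :
    φ.onNode t ∈ L.ball (φ.onNode s) n := by
  induction n generalizing t with
  | zero => rw [mem_ball_zero] at h ⊢; rw [h]
  | succ n ih =>
    obtain ⟨u, hu, rfl | hut⟩ := mem_ball_succ.1 h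
    · exact mem_ball_succ.2 ⟨_, ih hu, Or.inl rfl⟩
    · exact mem_ball_succ.2 ⟨_, ih hu, Or.inr (φ.adj_iff.2 hut)⟩

theorem ball_subset_image {s : L'.Node} {n : ℕ}
    (h : L.ball (φ.onNode s) n ⊆ Set.range φ.onNode) :
    L.ball (φ.onNode s) n ⊆ φ.onNode '' L'.ball s n := by
  induction n with
  | zero => exact fun t ht => ⟨s, mem_ball_zero.2 rfl, mem_ball_zero.1 ht⟩
  | succ n ih =>
    intro t ht
    obtain ⟨t, rfl⟩ := h ht
    obtain ⟨u, hu, hut⟩ := mem_ball_succ.1 ht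
    obtain ⟨u, hu', rfl⟩ := ih ((ball_mono _ n.le_succ).trans h) hu
    exact ⟨t, mem_ball_succ.2 ⟨u, hu', hut.imp (φ.onNode.injective ·) φ.adj_iff.1⟩, rfl⟩

theorem image_ball {s : L'.Node} {n : ℕ} (h : L.ball (φ.onNode s) n ⊆ Set.range φ.onNode) :
    φ.onNode '' L'.ball s n = L.ball (φ.onNode s) n :=
  Set.Subset.antisymm (Set.image_subset_iff.2 fun _ => φ.mem_ball_of_mem_ball)
    (φ.ball_subset_image h)

variable (ident : L.Node ↪ ℕ)

theorem rank_trans {s : L'.Node} (hs : L.graph.neighborSet (φ.onNode s) ⊆ Set.range φ.onNode)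
    (t : L'.Node) : rank (φ.onNode.trans ident) s t = rank ident (φ.onNode s) (φ.onNode t) := by
  rw [rank, ← Set.ncard_image_of_injective _ φ.onNode.injective]
  congr 1
  ext u
  constructor
  · rintro ⟨u, hu, rfl⟩
    exact ⟨φ.adj_iff.2 hu.1, hu.2⟩
  · rintro ⟨hu, hut⟩
    obtain ⟨u, rfl⟩ := hs hu
    exact ⟨u, ⟨φ.adj_iff.1 hu, hut⟩, rfl⟩

theorem localInput_ofIdent_trans {s : L'.Node}
    (hs : L.graph.neighborSet (φ.onNode s) ⊆ Set.range φ.onNode) :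
    (Labelling.ofIdent (φ.onNode.trans ident)).localInput s =
      (Labelling.ofIdent ident).localInput (φ.onNode s) := by
  have hport := φ.rank_trans ident hs
  cases s with
  | agent v =>
    exact congrArg₂ LocalInput.agent
      (setOf_exists_eq_congr φ.conEdge_iff (fun i hi => φ.con_mem_range_iff.1 (hs hi))
        fun i => congrArg₂ _ rfl (congrArg₂ _ (hport (.con i)) (φ.a_eq i v).symm))
      (setOf_exists_eq_congr φ.objEdge_iff (fun k hk => φ.obj_mem_range_iff.1 (hs hk))
        fun k => congrArg₂ _ rfl (congrArg₂ _ (hport (.obj k)) (φ.c_eq k v).symm))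
  | con i =>
    exact congrArg LocalInput.con
      (setOf_exists_eq_congr φ.conEdge_iff (fun v hv => φ.agent_mem_range_iff.1 (hs hv))
        fun v => congrArg₂ _ rfl (hport (.agent v)))
  | obj k =>
    exact congrArg LocalInput.obj
      (setOf_exists_eq_congr φ.objEdge_iff (fun v hv => φ.agent_mem_range_iff.1 (hs hv))
        fun v => congrArg₂ _ rfl (hport (.agent v)))

theorem output_ofIdent_trans {v : L'.V} {r : ℕ}
    (h : L.ball (.agent (φ.onV v)) (r + 1) ⊆ Set.range φ.onNode) (A : LocalRule) :
    (Labelling.ofIdent (φ.onNode.trans ident)).output A r v =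
      (Labelling.ofIdent ident).output A r (φ.onV v) := by
  have himage := φ.image_ball (s := .agent v) ((ball_mono _ r.le_succ).trans h)
  refine congrArg (A _) ?_
  rw [Labelling.view, Labelling.view, ← onNode_agent, ← himage, Set.image_image]
  refine Set.image_congr fun t ht => Prod.ext rfl ?_
  refine φ.localInput_ofIdent_trans ident fun u hu => h ?_
  exact mem_ball_succ.2 ⟨_, φ.mem_ball_of_mem_ball ht, Or.inr hu⟩

theorem objValue_onK {x' : L'.V → ℝ} {x : L.V → ℝ} {k : L'.K}
    (hrange : ∀ v, L.objEdge (φ.onK k) v → v ∈ Set.range φ.onV)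
    (hx : ∀ v, L'.objEdge k v → x' v = x (φ.onV v)) :
    L.objValue x (φ.onK k) = L'.objValue x' k := by
  have hagents : L.objAgents (φ.onK k) = (L'.objAgents k).map φ.onV := by
    ext v
    simp only [mem_objAgents, Finset.mem_map]
    constructor
    · intro hv
      obtain ⟨v, rfl⟩ := hrange v hv
      exact ⟨v, φ.objEdge_iff.1 hv, rfl⟩
    · rintro ⟨v, hv, rfl⟩
      exact φ.objEdge_iff.2 hv
  rw [objValue, objValue, hagents, Finset.sum_map]
  refine Finset.sum_congr rfl fun v hv => ?_
  rw [φ.c_eq, hx v (mem_objAgents.1 hv)]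

theorem opt_div_le_objValue_output {A : LocalRule} {r : ℕ} {α : ℝ} {F : Set MaxMinLP}
    (hA : IsLocalApproximation A r α F) (hL' : L' ∈ F) {k : L'.K}
    (h : L.ball (.obj (φ.onK k)) (r + 2) ⊆ Set.range φ.onNode) :
    L'.opt / (α : EReal) ≤
      (L.objValue ((Labelling.ofIdent ident).output A r) (φ.onK k) : EReal) := by
  have hball : ∀ v, L.objEdge (φ.onK k) v →
      L.ball (.agent v) (r + 1) ⊆ Set.range φ.onNode := fun v hv => by
    have hmem : Node.agent v ∈ L.ball (.obj (φ.onK k)) 1 :=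
      mem_ball_succ.2 ⟨_, mem_ball_zero.2 rfl, Or.inr hv⟩
    exact (ball_add_subset_ball_add hmem).trans (by rwa [add_comm])
  rw [φ.objValue_onK
    (fun v hv => φ.agent_mem_range_iff.1
      (hball v hv (ball_mono _ (Nat.zero_le _) (mem_ball_zero.2 rfl))))
    (fun v hv => φ.output_ofIdent_trans ident (hball _ (φ.objEdge_iff.2 hv)) A)]
  exact (hA.2 L' hL' _).2 k

end Embedding

/-! ### Bipartite max-min LPs with unit coefficients -/

section OfMaps

variable {V I K : Type} [Fintype V] [Fintype I] [Fintype K] (con : V → I) (obj : V → K)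

/-- The max-min LP with unit coefficients in which `con v` is the only constraint and `obj v` the
only objective of the agent `v`. -/
abbrev ofMaps : MaxMinLP where
  V := V
  I := I
  K := K
  conEdge i v := con v = i
  objEdge k v := obj v = k
  a _ _ := 1
  c _ _ := 1
  a_nonneg _ _ _ := zero_le_one
  c_nonneg _ _ _ := zero_le_one

theorem isBipartite_ofMaps : (ofMaps con obj).IsBipartite :=
  fun v => ⟨⟨con v, rfl, fun _ h => h.symm⟩, ⟨obj v, rfl, fun _ h => h.symm⟩⟩

theorem positiveCoefficients_ofMaps : (ofMaps con obj).PositiveCoefficients :=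
  ⟨fun _ _ _ => zero_lt_one, fun _ _ _ => zero_lt_one⟩

theorem linked_ofMaps_iff {p q : V} :
    (ofMaps con obj).Linked p q ↔ con p = con q ∨ obj p = obj q := by
  constructor
  · rintro (rfl | ⟨_ | i | k, hp, hq⟩)
    · exact Or.inl rfl
    · exact hp.elim
    · exact Or.inl (Eq.trans hp (Eq.symm hq))
    · exact Or.inr (Eq.trans hp (Eq.symm hq))
  · rintro (h | h)
    · exact Or.inr ⟨.con (con p), rfl, h.symm⟩
    · exact Or.inr ⟨.obj (obj p), rfl, h.symm⟩

instance : Std.Refl (α := V) (ofMaps con obj).Linked := ⟨fun _ => Or.inl rfl⟩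

open Classical in
theorem conValue_ofMaps (x : V → ℝ) (i : I) :
    (ofMaps con obj).conValue x i = ∑ v with con v = i, x v := by
  simp only [conValue, conAgents, one_mul]

open Classical in
theorem objValue_ofMaps (x : V → ℝ) (k : K) :
    (ofMaps con obj).objValue x k = ∑ v with obj v = k, x v := by
  simp only [objValue, objAgents, one_mul]

theorem sum_objValue_eq_sum_conValue (x : V → ℝ) :
    ∑ k, (ofMaps con obj).objValue x k = ∑ i, (ofMaps con obj).conValue x i := by
  classical
  simp only [conValue_ofMaps, objValue_ofMaps]
  exact (Finset.sum_fiberwise _ obj x).trans (Finset.sum_fiberwise _ con x).symm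

variable {con obj} in
theorem exists_objValue_le [Nonempty K] {x : V → ℝ} (hx : (ofMaps con obj).Feasible x) :
    ∃ k, (ofMaps con obj).objValue x k ≤ Fintype.card I / Fintype.card K := by
  have hK : (Fintype.card K : ℝ) ≠ 0 := Nat.cast_ne_zero.2 Fintype.card_ne_zero
  have hsum : ∑ k, (ofMaps con obj).objValue x k ≤
      ∑ _k : K, (Fintype.card I / Fintype.card K : ℝ) :=
    calc ∑ k, (ofMaps con obj).objValue x k
      _ = ∑ i, (ofMaps con obj).conValue x i := sum_objValue_eq_sum_conValue con obj x
      _ ≤ ∑ _i : I, (1 : ℝ) := Finset.sum_le_sum fun i _ => hx.1 i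
      _ = ∑ _k : K, (Fintype.card I / Fintype.card K : ℝ) := by
        simp [mul_div_cancel₀ _ hK]
  obtain ⟨k, -, hk⟩ := Finset.exists_le_of_sum_le Finset.univ_nonempty hsum
  exact ⟨k, hk⟩

end OfMaps

/-! ### Subdivisions -/

section HalfEdges

variable {U E : Type*} (ends : E → Bool → U)

/-- All vertices of a multigraph have degree at most `d`, where loops count twice. -/
def MaxDegreeLE (d : ℕ) : Prop :=
  ∀ u, {h : E × Bool | ends h.1 h.2 = u}.ncard ≤ d

/-- The half-edges at the vertices in `S`. -/
def halfEdges (S : Set U) : Set (E × Bool) :=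
  {h | ends h.1 h.2 ∈ S}

variable {ends}

theorem ncard_halfEdges_le [Finite U] [Finite E] {d : ℕ} (hdeg : MaxDegreeLE ends d) (S : Set U) :
    (halfEdges ends S).ncard ≤ d * S.ncard := by
  classical
  rw [Set.ncard_eq_toFinset_card (halfEdges ends S), Set.ncard_eq_toFinset_card S]
  refine Finset.card_le_mul_card_image_of_maps_to (f := fun h : E × Bool => ends h.1 h.2)
    (fun h hh => ?_) d fun u _ => ?_
  · rw [Set.Finite.mem_toFinset] at hh ⊢
    exact hh
  · rw [← Set.ncard_coe_finset]
    exact (Set.ncard_le_ncard fun h hh => (Finset.mem_filter.1 hh).2).trans (hdeg u)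

end HalfEdges

section Subdivision

variable {U E : Type} (ends : E → Bool → U) (n : ℕ)

/-- The constraint of an agent of the subdivision of the multigraph in which the edge `e` has the
ends `ends e false` and `ends e true`: each edge is replaced by a path of `2 * n + 2` agents, and
the constraints are the vertices of the multigraph (the branch vertices) and the pairs of the agents
at the positions `2 * j + 1` and `2 * j + 2` of a path. -/
def subdivCon (p : E × Fin (2 * n + 2)) : U ⊕ E × Fin n :=
  if _h₀ : (p.2 : ℕ) = 0 then .inl (ends p.1 false)
  else if _h₁ : (p.2 : ℕ) = 2 * n + 1 then .inl (ends p.1 true)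
  else .inr (p.1, ⟨(p.2 - 1) / 2, by lia⟩)

/-- The objective of an agent of a subdivision: the objectives are the pairs of the agents at the
positions `2 * j` and `2 * j + 1` of a path. -/
def subdivObj (p : E × Fin (2 * n + 2)) : E × Fin (n + 1) :=
  (p.1, ⟨p.2 / 2, by lia⟩)

/-- The max-min LP of the subdivision of a multigraph. -/
abbrev subdivision [Fintype U] [Fintype E] : MaxMinLP :=
  ofMaps (subdivCon ends n) (subdivObj (E := E) n)

variable {n} in
/-- The position on a path of `2 * n + 2` agents, counted from the end `b` of the path. -/
def depth (b : Bool) (q : Fin (2 * n + 2)) : Fin (2 * n + 2) :=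
  if b then q.rev else q

/-- The agent at the end `b` of the path that replaces the edge `e`. -/
def endAgent (e : E) (b : Bool) : E × Fin (2 * n + 2) :=
  (e, depth b 0)

variable {ends n}

theorem depth_injective (b : Bool) : Function.Injective (depth b : Fin (2 * n + 2) → _) := by
  cases b
  · exact fun _ _ h => h
  · exact Fin.rev_injective

theorem depth_depth (b : Bool) (q : Fin (2 * n + 2)) : depth b (depth b q) = q := by
  cases b
  · rfl
  · exact Fin.rev_rev q

theorem val_depth_not (b : Bool) (q : Fin (2 * n + 2)) :
    (depth (!b) q : ℕ) = 2 * n + 1 - depth b q := by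
  cases b <;> simp only [depth, Bool.not_false, Bool.not_true, if_true, if_false,
    Bool.false_eq_true, Fin.val_rev] <;> lia

theorem subdivCon_eq_inl {p : E × Fin (2 * n + 2)} {u : U} (h : subdivCon ends n p = .inl u) :
    ∃ b, p = endAgent n p.1 b ∧ ends p.1 b = u := by
  simp only [subdivCon] at h
  split_ifs at h with h₀ h₁
  · exact ⟨false, Prod.ext rfl (Fin.ext h₀), Sum.inl.inj h⟩
  · exact ⟨true, Prod.ext rfl (Fin.ext h₁), Sum.inl.inj h⟩

theorem subdivCon_eq_inr {p : E × Fin (2 * n + 2)} {e : E} {j : Fin n}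
    (h : subdivCon ends n p = .inr (e, j)) :
    p.1 = e ∧ ((p.2 : ℕ) = 2 * j + 1 ∨ (p.2 : ℕ) = 2 * j + 2) := by
  simp only [subdivCon] at h
  split_ifs at h
  simp only [Sum.inr.injEq, Prod.mk.injEq, Fin.ext_iff] at h
  exact ⟨h.1, by lia⟩

theorem subdivObj_eq_iff {p : E × Fin (2 * n + 2)} {e : E} {j : Fin (n + 1)} :
    subdivObj n p = (e, j) ↔ p.1 = e ∧ ((p.2 : ℕ) = 2 * j ∨ (p.2 : ℕ) = 2 * j + 1) := by
  simp only [subdivObj, Prod.mk.injEq, Fin.ext_iff]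
  lia

variable [Fintype U] [Fintype E]

theorem linked_subdivision {p₀ p : E × Fin (2 * n + 2)} (h : (subdivision ends n).Linked p₀ p) :
    (p₀.1 = p.1 ∧ (p₀.2 : ℕ) ≤ p.2 + 1 ∧ (p.2 : ℕ) ≤ p₀.2 + 1) ∨
      ∃ b₀ b, p₀ = endAgent n p₀.1 b₀ ∧ p = endAgent n p.1 b ∧ ends p₀.1 b₀ = ends p.1 b := by
  obtain h | h := (linked_ofMaps_iff _ _).1 h
  · rcases hp : subdivCon ends n p with u | ⟨e, j⟩
    · obtain ⟨b, hb, hbu⟩ := subdivCon_eq_inl hp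
      obtain ⟨b₀, hb₀, hbu₀⟩ := subdivCon_eq_inl (h.trans hp)
      exact Or.inr ⟨b₀, b, hb₀, hb, hbu₀.trans hbu.symm⟩
    · obtain ⟨he, hj⟩ := subdivCon_eq_inr hp
      obtain ⟨he₀, hj₀⟩ := subdivCon_eq_inr (h.trans hp)
      exact Or.inl ⟨he₀.trans he.symm, by lia, by lia⟩
  · rcases hp : subdivObj n p with ⟨e, j⟩
    obtain ⟨he, hj⟩ := subdivObj_eq_iff.1 hp
    obtain ⟨he₀, hj₀⟩ := subdivObj_eq_iff.1 (h.trans hp)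
    exact Or.inl ⟨he₀.trans he.symm, by lia, by lia⟩

theorem objAgents_subdivision (e : E) (j : Fin (n + 1)) :
    (subdivision ends n).objAgents (e, j) =
      .cons (e, ⟨2 * j, by lia⟩) {(e, ⟨2 * j + 1, by lia⟩)} (by simp [Fin.ext_iff]) := by
  ext p
  refine mem_objAgents.trans (subdivObj_eq_iff.trans ?_)
  simp only [Finset.mem_cons, Finset.mem_singleton, Prod.ext_iff, Fin.ext_iff, and_or_left]

theorem objValue_subdivision (x : E × Fin (2 * n + 2) → ℝ) (e : E) (j : Fin (n + 1)) :
    (subdivision ends n).objValue x (e, j) =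
      x (e, ⟨2 * j, by lia⟩) + x (e, ⟨2 * j + 1, by lia⟩) := by
  simp only [objValue, objAgents_subdivision, one_mul, Finset.sum_cons, Finset.sum_singleton]

theorem degreeBounded_subdivision {d ΔI ΔK : ℕ} (hdeg : MaxDegreeLE ends d) (hdI : d ≤ ΔI)
    (hI : 2 ≤ ΔI) (hK : 2 ≤ ΔK) : (subdivision ends n).DegreeBounded ΔI ΔK := by
  classical
  constructor
  · rintro (u | ⟨e, j⟩)
    · have hsub : ((subdivision ends n).conAgents (.inl u) : Set (E × Fin (2 * n + 2))) ⊆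
          (fun h : E × Bool => endAgent n h.1 h.2) '' {h | ends h.1 h.2 = u} := by
        intro p hp
        obtain ⟨b, hb, hbu⟩ := subdivCon_eq_inl (mem_conAgents.1 hp)
        exact ⟨(p.1, b), hbu, hb.symm⟩
      rw [← Set.ncard_coe_finset]
      exact (Set.ncard_le_ncard hsub).trans
        ((Set.ncard_image_le (Set.toFinite _)).trans ((hdeg u).trans hdI))
    · have hsub : (subdivision ends n).conAgents (.inr (e, j)) ⊆
          {(e, ⟨2 * j + 1, by lia⟩), (e, ⟨2 * j + 2, by lia⟩)} := by
        intro p hp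
        obtain ⟨he, hj⟩ := subdivCon_eq_inr (mem_conAgents.1 hp)
        simpa [Prod.ext_iff, Fin.ext_iff, he] using hj
      exact (Finset.card_le_card hsub).trans (Finset.card_le_two.trans hI)
  · rintro ⟨e, j⟩
    rw [objAgents_subdivision]
    exact (Finset.card_cons _).trans_le hK

end Subdivision

/-! ### Growth of subdivisions -/

section Growth

variable {U E : Type} [Fintype U] [Fintype E] {ends : E → Bool → U} {n : ℕ}

variable (ends) in
/-- The branch vertices that are adjacent to an agent within `t` steps of `v`. -/
def touched (v : E × Fin (2 * n + 2)) (t : ℕ) : Set U :=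
  {u | ∃ e b, ends e b = u ∧ endAgent n e b ∈ reach (subdivision ends n).Linked v t}

variable (ends) in
/-- The edges all of whose agents are within `t` steps of `v`. -/
def explored (v : E × Fin (2 * n + 2)) (t : ℕ) : Set E :=
  {e | ∀ q, (e, q) ∈ reach (subdivision ends n).Linked v t}

variable {v : E × Fin (2 * n + 2)} {t : ℕ}

theorem touched_mono : Monotone (touched ends v) :=
  fun _ _ hst _ ⟨e, b, hu, hr⟩ => ⟨e, b, hu, reach_mono hst hr⟩

theorem explored_mono : Monotone (explored ends v) :=
  fun _ _ hst _ he q => reach_mono hst (he q)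

theorem exists_touched_of_mem_reach {p : E × Fin (2 * n + 2)}
    (hp : p ∈ reach (subdivision ends n).Linked v (t + 1)) (hpv : p.1 ≠ v.1) :
    ∃ b, ends p.1 b ∈ touched ends v t ∧ ∀ q, depth b q < depth b p.2 →
      (p.1, q) ∈ reach (subdivision ends n).Linked v t := by
  induction t generalizing p with
  | zero =>
    obtain ⟨p₀, rfl, hlink⟩ := hp
    obtain ⟨he, -⟩ | ⟨b₀, b, hb₀, hb, heq⟩ := linked_subdivision hlink
    · exact absurd he.symm hpv
    · refine ⟨b, ⟨_, b₀, heq, hb₀.symm⟩, fun q hq => ?_⟩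
      rw [hb, endAgent, depth_depth] at hq
      exact absurd hq (Fin.not_lt_zero _)
  | succ t ih =>
    obtain ⟨p₀, hp₀, hlink⟩ := hp
    obtain ⟨he, hle, hle'⟩ | ⟨b₀, b, hb₀, hb, heq⟩ := linked_subdivision hlink
    · obtain ⟨b, hb, hq⟩ := ih hp₀ (he ▸ hpv)
      rw [he] at hb hq
      refine ⟨b, touched_mono t.le_succ hb, fun q hlt => ?_⟩
      by_cases hqp : q = p₀.2
      · rwa [hqp, ← he]
      · refine reach_mono t.le_succ (hq q ?_)
        rw [Fin.ext_iff] at hqp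
        cases b <;> simp only [depth, if_true, if_false, Bool.false_eq_true, Fin.lt_def,
          Fin.val_rev] at hlt ⊢ <;> lia
    · refine ⟨b, ⟨_, b₀, heq, hb₀ ▸ hp₀⟩, fun q hq => ?_⟩
      rw [hb, endAgent, depth_depth] at hq
      exact absurd hq (Fin.not_lt_zero _)

theorem exists_explored_of_mem_touched {u : U} (hu : u ∈ touched ends v (t + 1))
    (hnew : u ∉ touched ends v t) (huv : u ∉ Set.range (ends v.1)) :
    ∃ e b, ends e b = u ∧ ends e (!b) ∈ touched ends v t ∧
      e ∈ explored ends v (t + 1) \ explored ends v t := by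
  obtain ⟨e, b, rfl, hr⟩ := hu
  have hev : e ≠ v.1 := fun h => huv ⟨b, h ▸ rfl⟩
  obtain ⟨b', hb', hq⟩ := exists_touched_of_mem_reach hr hev
  obtain rfl : b' = !b := Bool.eq_not.2 fun h => hnew (h ▸ hb')
  refine ⟨e, b, rfl, hb', fun q => ?_, fun h => hnew ⟨e, b, rfl, h _⟩⟩
  by_cases hqb : q = depth b 0
  · exact hqb ▸ hr
  · refine reach_mono t.le_succ (hq q ?_)
    have hpos : depth b q ≠ 0 := fun h => hqb (by rw [← h, depth_depth])
    rw [Fin.lt_def, val_depth_not, endAgent, val_depth_not, depth_depth]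
    rw [Ne, Fin.ext_iff] at hpos
    lia

theorem ncard_touched_diff_le :
    (touched ends v t \ Set.range (ends v.1)).ncard ≤ (explored ends v t).ncard := by
  induction t with
  | zero =>
    suffices h : touched ends v 0 ⊆ Set.range (ends v.1) by
      rw [Set.sdiff_eq_empty.2 h, Set.ncard_empty]
      exact Nat.zero_le _
    rintro _ ⟨e, b, rfl, hr⟩
    exact ⟨b, congrArg (ends ·.1 b) (Eq.symm hr)⟩
  | succ t ih =>
    set new := (touched ends v (t + 1) \ Set.range (ends v.1)) \ touched ends v t
    have hnew : new.ncard ≤ (explored ends v (t + 1) \ explored ends v t).ncard := by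
      have : Nonempty E := ⟨v.1⟩
      choose! e b hend htouched hexplored using fun u (hu : u ∈ new) =>
        exists_explored_of_mem_touched hu.1.1 hu.2 hu.1.2
      refine Set.ncard_le_ncard_of_injOn e hexplored fun u hu u' hu' heq => ?_
      rw [← hend u hu, ← hend u' hu', heq]
      refine congrArg _ (Bool.not_eq_not.1 fun hb => hu.2 ?_)
      rw [← hend u hu, hb, heq]
      exact htouched u' hu'
    have hsub : touched ends v (t + 1) \ Set.range (ends v.1) ⊆
        touched ends v t \ Set.range (ends v.1) ∪ new := fun u hu =>
      (em (u ∈ touched ends v t)).imp (fun h => ⟨h, hu.2⟩) fun h => ⟨hu, h⟩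
    calc (touched ends v (t + 1) \ Set.range (ends v.1)).ncard
      _ ≤ (touched ends v t \ Set.range (ends v.1) ∪ new).ncard := Set.ncard_le_ncard hsub
      _ ≤ _ := Set.ncard_union_le _ _
      _ ≤ (explored ends v t).ncard + (explored ends v (t + 1) \ explored ends v t).ncard :=
        add_le_add ih hnew
      _ = (explored ends v (t + 1)).ncard := by
        rw [add_comm, Set.ncard_sdiff_add_ncard_of_subset (explored_mono t.le_succ)]

theorem ncard_touched_le : (touched ends v t).ncard ≤ (explored ends v t).ncard + 2 := by
  have hrange : (Set.range (ends v.1)).ncard ≤ 2 := by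
    rw [← Set.image_univ]
    exact (Set.ncard_image_le (Set.toFinite _)).trans_eq (by simp)
  exact (tsub_le_iff_right.1 (Set.le_ncard_sdiff _ _ (Set.toFinite _))).trans
    (add_le_add ncard_touched_diff_le hrange)

theorem ncard_sphere_diff_le :
    ((reach (subdivision ends n).Linked v (t + 1) \ reach (subdivision ends n).Linked v t) \
        {p | p.1 = v.1}).ncard ≤
      (halfEdges ends (touched ends v t) \ explored ends v t ×ˢ Set.univ).ncard := by
  set new := (reach (subdivision ends n).Linked v (t + 1) \
    reach (subdivision ends n).Linked v t) \ {p | p.1 = v.1}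
  -- On a path, the new agents are the fronts that move in from its ends; `b p` is the end of `p`.
  choose! b htouched hq using fun p (hp : p ∈ new) => exists_touched_of_mem_reach hp.1.1 hp.2
  have hlt : ∀ p ∈ new, ∀ p' ∈ new, p.1 = p'.1 → b p = b p' →
      ¬ depth (b p) p.2 < depth (b p) p'.2 := by
    intro p hp p' hp' he hb hlt
    have hmem := hq p' hp' p.2 (hb ▸ hlt)
    rw [← he] at hmem
    exact hp.1.2 hmem
  refine Set.ncard_le_ncard_of_injOn (fun p => (p.1, b p))
    (fun p hp => ⟨htouched p hp, fun h => hp.1.2 (h.1 p.2)⟩) fun p hp p' hp' heq => ?_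
  obtain ⟨he, hb⟩ := Prod.mk.inj heq
  refine Prod.ext he (depth_injective (b p) (le_antisymm ?_ ?_))
  · exact not_lt.1 (hb ▸ hlt p' hp' p hp he.symm hb.symm)
  · exact not_lt.1 (hlt p hp p' hp' he hb)

theorem ncard_reach_succ_le {d : ℕ} (hdeg : MaxDegreeLE ends d) :
    (reach (subdivision ends n).Linked v (t + 1)).ncard + 2 * (explored ends v t).ncard ≤
      (reach (subdivision ends n).Linked v t).ncard + d * ((explored ends v t).ncard + 2) +
        (2 * n + 2) := by
  have hpath : {p : E × Fin (2 * n + 2) | p.1 = v.1}.ncard ≤ 2 * n + 2 := by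
    have hsub : {p : E × Fin (2 * n + 2) | p.1 = v.1} ⊆ Set.range (Prod.mk v.1) :=
      fun p hp => ⟨p.2, Prod.ext (Eq.symm hp) rfl⟩
    refine (Set.ncard_le_ncard hsub).trans ?_
    rw [← Set.image_univ]
    exact (Set.ncard_image_le (Set.toFinite _)).trans_eq (by simp)
  have hsphere := Set.le_ncard_sdiff {p : E × Fin (2 * n + 2) | p.1 = v.1}
    (reach (subdivision ends n).Linked v (t + 1) \ reach (subdivision ends n).Linked v t)
    (Set.toFinite _)
  have hnew := ncard_sphere_diff_le (ends := ends) (v := v) (t := t)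
  have hhalf := Set.ncard_sdiff_add_ncard_of_subset
    (show explored ends v t ×ˢ Set.univ ⊆ halfEdges ends (touched ends v t) from
      fun h hh => ⟨h.1, h.2, rfl, hh.1 _⟩)
  rw [Set.ncard_prod, Set.ncard_univ, Nat.card_eq_fintype_card, Fintype.card_bool] at hhalf
  have hdeg := (ncard_halfEdges_le hdeg (touched ends v t)).trans
    (Nat.mul_le_mul_left d ncard_touched_le)
  have hreach := Set.ncard_sdiff_add_ncard_of_subset
    (reach_mono (R := (subdivision ends n).Linked) (x := v) t.le_succ)
  lia

theorem mul_ncard_explored_le : (2 * n + 2) * (explored ends v t).ncard ≤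
    (reach (subdivision ends n).Linked v t).ncard := by
  have hsub : explored ends v t ×ˢ (Set.univ : Set (Fin (2 * n + 2))) ⊆
      reach (subdivision ends n).Linked v t := fun p hp => hp.1 p.2
  have hcard := Set.ncard_le_ncard hsub
  rwa [Set.ncard_prod, Set.ncard_univ, Nat.card_fin, mul_comm] at hcard

theorem boundedRelativeGrowth_subdivision {d : ℕ} (hd : 2 ≤ d) (hdeg : MaxDegreeLE ends d) {δ : ℝ}
    {R : ℕ} (hR : 2 * (2 * d + 2 * n + 2) ≤ (δ - (d - 2) / (2 * n + 2)) * R) :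
    (subdivision ends n).BoundedRelativeGrowth δ R := by
  intro v r hr
  rw [ballAgentCount_eq_ncard_reach, ballAgentCount_eq_ncard_reach, Nat.add_div_right r two_pos]
  set t := r / 2
  set γ : ℝ := (d - 2) / (2 * n + 2)
  set a := (reach (subdivision ends n).Linked v t).ncard with ha
  have hd' : (2 : ℝ) ≤ d := Nat.ofNat_le_cast.2 hd
  have hγ : 0 ≤ γ := div_nonneg (by linarith) (by positivity)
  have hδ : 0 < δ - γ := pos_of_mul_pos_left (lt_of_lt_of_le (by positivity) hR) R.cast_nonneg
  have hpos : (0 : ℝ) < a := Nat.cast_pos.2 ((Set.ncard_pos).2 ⟨v, mem_reach_self t⟩)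
  rw [div_le_iff₀ hpos]
  by_cases hne : reach (subdivision ends n).Linked v (t + 1) = reach (subdivision ends n).Linked v t
  · rw [hne, ← ha]
    exact le_mul_of_one_le_left hpos.le (by linarith)
  have hRa : (R : ℝ) ≤ 2 * a := by
    have hlt := lt_ncard_reach hne
    exact_mod_cast (show R ≤ 2 * a by lia)
  have hexplored : (d - 2 : ℝ) * (explored ends v t).ncard ≤ γ * a := by
    rw [div_mul_eq_mul_div, le_div_iff₀ (by positivity), mul_assoc]
    refine mul_le_mul_of_nonneg_left ?_ (by linarith)
    rw [mul_comm]
    exact_mod_cast mul_ncard_explored_le (ends := ends) (v := v) (t := t)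
  have hsucc : ((reach (subdivision ends n).Linked v (t + 1)).ncard : ℝ) +
      2 * (explored ends v t).ncard ≤
        a + d * ((explored ends v t).ncard + 2) + (2 * n + 2) := by
    exact_mod_cast ncard_reach_succ_le (v := v) (t := t) hdeg
  linarith [mul_le_mul_of_nonneg_left hRa hδ.le]

end Growth

/-! ### Values of subdivisions -/

section Values

variable {U E : Type} {ends : E → Bool → U} {n : ℕ}

/-- A multigraph is a pseudoforest if each connected component has at most one cycle. Equivalently,
one can assign to each edge one of its ends in such a way that different edges get different
vertices; the definition is in terms of these assignments. -/
def IsPseudoforest (ends : E → Bool → U) : Prop :=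
  ∃ β : E → Bool, Function.Injective fun e => ends e (β e)

/-- The solution of a subdivision that is alternately `1` and `0` along the path of each edge `e`,
starting with `1` at the end `β e`. -/
def alternating (β : E → Bool) (p : E × Fin (2 * n + 2)) : ℝ :=
  if Even (depth (β p.1) p.2 : ℕ) then 1 else 0

theorem eq_of_even_depth_endAgent {β : E → Bool} {e : E} {b : Bool}
    (h : Even (depth (β e) (endAgent n e b).2 : ℕ)) : b = β e := by
  by_contra hb
  obtain rfl := Bool.eq_not.2 hb
  have hval := val_depth_not (!β e) (depth (!β e) (0 : Fin (2 * n + 2)))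
  rw [Bool.not_not, depth_depth] at hval
  rw [endAgent, hval, Fin.val_zero, Nat.even_iff] at h
  lia

variable [Fintype U] [Fintype E]

theorem feasible_alternating {β : E → Bool} (hβ : Function.Injective fun e => ends e (β e)) :
    (subdivision ends n).Feasible (alternating β) := by
  classical
  refine ⟨fun i => ?_, fun p => ite_nonneg zero_le_one le_rfl⟩
  simp only [conValue_ofMaps, alternating, Finset.sum_boole, Finset.filter_filter]
  refine Nat.cast_le_one.2 (Finset.card_le_one.2 fun p hp p' hp' => ?_)
  simp only [Finset.mem_filter, Finset.mem_univ, true_and] at hp hp'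
  obtain ⟨hp, heven⟩ := hp
  obtain ⟨hp', heven'⟩ := hp'
  rcases i with u | ⟨e, j⟩
  · obtain ⟨b, hb, hbu⟩ := subdivCon_eq_inl hp
    obtain ⟨b', hb', hbu'⟩ := subdivCon_eq_inl hp'
    obtain rfl : b = β p.1 := eq_of_even_depth_endAgent (hb ▸ heven)
    obtain rfl : b' = β p'.1 := eq_of_even_depth_endAgent (hb' ▸ heven')
    rw [hb, hb', hβ (hbu.trans hbu'.symm)]
  · obtain ⟨he, hj⟩ := subdivCon_eq_inr hp
    obtain ⟨he', hj'⟩ := subdivCon_eq_inr hp'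
    rw [he] at heven
    rw [he'] at heven'
    refine Prod.ext (he.trans he'.symm) (Fin.ext ?_)
    cases h : β e <;> simp only [h, depth, if_true, if_false, Bool.false_eq_true, Fin.val_rev,
      Nat.even_iff] at heven heven' <;> lia

theorem objValue_alternating (β : E → Bool) (k : E × Fin (n + 1)) :
    (subdivision ends n).objValue (alternating β) k = 1 := by
  obtain ⟨e, j⟩ := k
  rw [objValue_subdivision]
  have hodd : ¬ Even (2 * n + 1 - 2 * (j : ℕ)) := by rw [Nat.even_iff]; lia
  have heven : Even (2 * n - 2 * (j : ℕ)) := by rw [Nat.even_iff]; lia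
  cases h : β e <;> simp [alternating, h, depth, hodd, heven]

theorem one_le_opt_subdivision (h : IsPseudoforest ends) : 1 ≤ (subdivision ends n).opt := by
  obtain ⟨β, hβ⟩ := h
  refine le_iSup₂_of_le (alternating β) (feasible_alternating hβ) (le_iInf fun k => ?_)
  rw [objValue_alternating, EReal.coe_one]

theorem exists_objValue_subdivision_le [Nonempty E] {d : ℕ} (hd : 0 < d)
    (hcard : d * Fintype.card U = 2 * Fintype.card E) {x : E × Fin (2 * n + 2) → ℝ}
    (hx : (subdivision ends n).Feasible x) :
    ∃ k, (subdivision ends n).objValue x k ≤ (d * n + 2) / (d * n + d) := by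
  obtain ⟨k, hk⟩ := exists_objValue_le hx
  refine ⟨k, hk.trans_eq ?_⟩
  have hcard' : (d * Fintype.card U : ℝ) = 2 * Fintype.card E := mod_cast hcard
  have : (d : ℝ) ≠ 0 := Nat.cast_ne_zero.2 hd.ne'
  have : (Fintype.card E : ℝ) ≠ 0 := Nat.cast_ne_zero.2 Fintype.card_ne_zero
  simp only [Fintype.card_sum, Fintype.card_prod, Fintype.card_fin, Nat.cast_add, Nat.cast_mul,
    Nat.cast_one]
  rw [div_eq_div_iff (by positivity) (by positivity)]
  linear_combination (n + 1 : ℝ) * hcard'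

end Values

/-! ### Restriction to a set of edges -/

section Restriction

variable {U E : Type} {ends : E → Bool → U} {n : ℕ} {S : Set E}

theorem MaxDegreeLE.restrict [Finite E] {d : ℕ} (h : MaxDegreeLE ends d) (S : Set E) :
    MaxDegreeLE (fun e : S => ends e) d := fun u =>
  (Set.ncard_le_ncard_of_injOn (Prod.map Subtype.val id) (fun _ he => he)
    (Subtype.val_injective.prodMap Function.injective_id).injOn (Set.toFinite _)).trans (h u)

theorem IsPseudoforest.mono {T : Set E} (h : IsPseudoforest fun e : T => ends e) (hST : S ⊆ T) :
    IsPseudoforest fun e : S => ends e := by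
  obtain ⟨β, hβ⟩ := h
  exact ⟨fun e => β (Set.inclusion hST e), hβ.comp (Set.inclusion_injective hST)⟩

variable (ends) in
/-- Two edges share an end if they are equal or incident to a common vertex. -/
def ShareEnd (e e' : E) : Prop :=
  ∃ b b', ends e b = ends e' b'

instance : Std.Refl (ShareEnd ends) := ⟨fun _ => ⟨false, false, rfl⟩⟩

variable [Fintype U] [Fintype E]

variable (ends n S) in
/-- The subdivision of a part of a multigraph as a part of the subdivision. -/
def restrictEmbedding [Fintype S] :
    Embedding (subdivision (fun e : S => ends e) n) (subdivision ends n) where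
  onV := (Function.Embedding.subtype _).prodMap (.refl _)
  onI := (Function.Embedding.refl U).sumMap ((Function.Embedding.subtype _).prodMap (.refl _))
  onK := (Function.Embedding.subtype _).prodMap (.refl _)
  conEdge_iff {i p} := by
    have hcon : subdivCon ends n (p.1, p.2) =
        ((Function.Embedding.refl U).sumMap ((Function.Embedding.subtype _).prodMap (.refl _)))
          (subdivCon (fun e : S => ends e) n p) := by
      simp only [subdivCon]
      split_ifs <;> rfl
    exact (Eq.congr_left hcon).trans (Function.Embedding.injective _).eq_iff
  objEdge_iff {k p} :=
    ((Function.Embedding.subtype _).prodMap (.refl _)).injective.eq_iff (a := subdivObj n p)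
  a_eq _ _ := rfl
  c_eq _ _ := rfl

theorem fst_mem_reach_shareEnd {p q : E × Fin (2 * n + 2)} {t : ℕ}
    (h : q ∈ reach (subdivision ends n).Linked p t) : q.1 ∈ reach (ShareEnd ends) p.1 t := by
  induction t generalizing q with
  | zero => exact congrArg Prod.fst h
  | succ t ih =>
    obtain ⟨q₀, hq₀, hlink⟩ := h
    obtain ⟨he, -⟩ | ⟨b₀, b, -, -, heq⟩ := linked_subdivision hlink
    · exact he ▸ reach_mono t.le_succ (ih hq₀)
    · exact ⟨q₀.1, ih hq₀, b₀, b, heq⟩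

theorem ball_agent_subset_range [Fintype S] {p : E × Fin (2 * n + 2)} {t : ℕ}
    (hS : reach (ShareEnd ends) p.1 t ⊆ S) :
    (subdivision ends n).ball (.agent p) t ⊆ Set.range (restrictEmbedding ends n S).onNode := by
  intro s hs
  obtain ⟨q, hq, hqs⟩ := exists_agent_mem_ball hs
  have hqS : q.1 ∈ S :=
    hS (reach_mono (Nat.div_le_self t 2) (fst_mem_reach_shareEnd (agent_mem_ball_iff.1 hq)))
  obtain rfl | hadj := hqs
  · exact ⟨.agent (⟨q.1, hqS⟩, q.2), rfl⟩
  rcases s with _ | (u | ⟨e, j⟩) | ⟨e, j⟩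
  · exact hadj.elim
  · exact ⟨.con (.inl u), rfl⟩
  · obtain ⟨rfl, -⟩ := subdivCon_eq_inr hadj
    exact ⟨.con (.inr (⟨q.1, hqS⟩, j)), rfl⟩
  · obtain ⟨rfl, -⟩ := subdivObj_eq_iff.1 hadj
    exact ⟨.obj (⟨q.1, hqS⟩, j), rfl⟩

end Restriction

/-! ### Regular multigraphs of large girth -/

section Cayley

variable (C : Type) (D : ℕ)

/-- Words without two equal consecutive letters, of length at most `D`. They are the elements of
length at most `D` in the free product of copies of the group of order two, one for each letter. -/
abbrev ReducedWord : Type :=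
  {w : List C // w.IsChain (· ≠ ·) ∧ w.length ≤ D}

instance [Finite C] : Finite (ReducedWord C D) :=
  ((List.finite_length_le C D).subset fun _ h => h.2).to_subtype

noncomputable instance [Finite C] : Fintype (ReducedWord C D) := Fintype.ofFinite _

variable {C D}

theorem isChain_ne_cons_iff {c : C} {w : List C} :
    (c :: w).IsChain (· ≠ ·) ↔ w.head? ≠ some c ∧ w.IsChain (· ≠ ·) := by
  rw [List.isChain_cons]
  refine and_congr_left fun _ => ⟨fun h hc => h c hc rfl, ?_⟩
  rintro h y hy rfl
  exact h hy

variable [DecidableEq C]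

/-- Cancel the letter `c` at the front of a word, or put it there if the length permits. -/
def toggle (c : C) (w : ReducedWord C D) : ReducedWord C D :=
  if h : w.1.head? = some c then
    ⟨w.1.tail, w.2.1.tail, (List.tail_sublist _).length_le.trans w.2.2⟩
  else if hl : w.1.length < D then ⟨c :: w.1, isChain_ne_cons_iff.2 ⟨h, w.2.1⟩, hl⟩
  else w

theorem toggle_cons {c : C} {w : List C} (h : (c :: w).IsChain (· ≠ ·))
    (hl : (c :: w).length ≤ D) :
    toggle c ⟨c :: w, h, hl⟩ = ⟨w, h.tail, (Nat.le_succ _).trans hl⟩ := by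
  simp [toggle]

theorem toggle_eq_cons {c : C} {w : List C} (h : (c :: w).IsChain (· ≠ ·))
    (hl : (c :: w).length ≤ D) :
    toggle c ⟨w, h.tail, (Nat.le_succ _).trans hl⟩ = ⟨c :: w, h, hl⟩ := by
  simp [toggle, (isChain_ne_cons_iff.1 h).1, Nat.lt_of_succ_le hl]

theorem toggle_involutive (c : C) : Function.Involutive (toggle (D := D) c) := by
  rintro ⟨w, hw, hl⟩
  by_cases h : w.head? = some c
  · obtain ⟨w, rfl⟩ := List.head?_eq_some_iff.1 h
    rw [toggle_cons hw hl, toggle_eq_cons hw hl]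
  · by_cases hlt : w.length < D
    · have hcw : (c :: w).IsChain (· ≠ ·) := isChain_ne_cons_iff.2 ⟨h, hw⟩
      rw [toggle_eq_cons hcw hlt, toggle_cons hcw hlt]
    · simp [toggle, h, hlt]

/-- The permutation of the reduced words that toggles the letter `c`. -/
def togglePerm (c : C) : Equiv.Perm (ReducedWord C D) := (toggle_involutive c).toPerm

theorem togglePerm_mul_togglePerm_mul (c : C) (g : Equiv.Perm (ReducedWord C D)) :
    togglePerm c * (togglePerm c * g) = g :=
  Equiv.ext fun _ => toggle_involutive c _

variable (C D) in
/-- The vertices of the bipartite double cover of the Cayley graph of the permutations of the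
reduced words with respect to the toggles. -/
abbrev CayleyVertex : Type := Equiv.Perm (ReducedWord C D) × Bool

variable (C D) in
/-- The edges of the bipartite double cover. The edge `(g, c)` has the colour `c` and joins
`(g, false)` to `(togglePerm c * g, true)`. -/
abbrev CayleyEdge : Type := Equiv.Perm (ReducedWord C D) × C

/-- The ends of the edges of the bipartite double cover. -/
def cayleyEnds (e : CayleyEdge C D) (b : Bool) : CayleyVertex C D :=
  (if b then togglePerm e.2 * e.1 else e.1, b)

/-- The edge of colour `c` at the vertex `u`. -/
def incidentEdge (c : C) (u : CayleyVertex C D) : CayleyEdge C D :=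
  (if u.2 then togglePerm c * u.1 else u.1, c)

/-- The neighbour of the vertex `u` along the edge of colour `c`. -/
def neighbor (c : C) (u : CayleyVertex C D) : CayleyVertex C D :=
  (togglePerm c * u.1, !u.2)

theorem incidentEdge_neighbor (c : C) (u : CayleyVertex C D) :
    incidentEdge c (neighbor c u) = incidentEdge c u := by
  obtain ⟨g, b⟩ := u
  cases b <;> simp [incidentEdge, neighbor, togglePerm_mul_togglePerm_mul]

theorem cayleyEnds_incidentEdge (c : C) (u : CayleyVertex C D) :
    cayleyEnds (incidentEdge c u) u.2 = u := by
  obtain ⟨g, b⟩ := u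
  cases b <;> simp [incidentEdge, cayleyEnds, togglePerm_mul_togglePerm_mul]

theorem cayleyEnds_incidentEdge_not (c : C) (u : CayleyVertex C D) :
    cayleyEnds (incidentEdge c u) (!u.2) = neighbor c u := by
  rw [← incidentEdge_neighbor]
  exact cayleyEnds_incidentEdge c (neighbor c u)

theorem incidentEdge_cayleyEnds (e : CayleyEdge C D) (b : Bool) :
    incidentEdge e.2 (cayleyEnds e b) = e := by
  obtain ⟨g, c⟩ := e
  cases b <;> simp [incidentEdge, cayleyEnds, togglePerm_mul_togglePerm_mul]

theorem maxDegreeLE_cayleyEnds [Finite C] :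
    MaxDegreeLE (cayleyEnds (C := C) (D := D)) (Nat.card C) := by
  intro u
  have hsub : {h : CayleyEdge C D × Bool | cayleyEnds h.1 h.2 = u} ⊆
      (fun c => (incidentEdge c u, u.2)) '' Set.univ := by
    rintro ⟨e, b⟩ rfl
    exact ⟨e.2, trivial, Prod.ext (incidentEdge_cayleyEnds e b) rfl⟩
  rw [← Set.ncard_univ]
  exact (Set.ncard_le_ncard hsub (Set.toFinite _)).trans (Set.ncard_image_le (Set.toFinite _))

variable (g : Equiv.Perm (ReducedWord C D))

/-- The end of the walk from `(g, false)` along the colours of `w`, the last letter first. -/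
def walkEnd (w : List C) : CayleyVertex C D :=
  w.foldr neighbor (g, false)

theorem walkEnd_cons (c : C) (w : List C) : walkEnd g (c :: w) = neighbor c (walkEnd g w) := rfl

/-- The word can be read off from the end of its walk, so walks of length at most `D` that do not
backtrack do not close up. -/
theorem walkEnd_apply {w : List C} (hw : w.IsChain (· ≠ ·)) (hl : w.length ≤ D) :
    (walkEnd g w).1 (g⁻¹ ⟨[], .nil, D.zero_le⟩) = ⟨w, hw, hl⟩ := by
  induction w with
  | nil => simp [walkEnd]
  | cons c w ih =>
    rw [walkEnd_cons, neighbor, Equiv.Perm.mul_apply, ih hw.tail ((Nat.le_succ _).trans hl)]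
    exact toggle_eq_cons hw hl

theorem injOn_walkEnd : Set.InjOn (walkEnd g) {w | w.IsChain (· ≠ ·) ∧ w.length ≤ D} := by
  intro w hw w' hw' h
  have happly := walkEnd_apply g hw.1 hw.2
  rw [h, walkEnd_apply g hw'.1 hw'.2] at happly
  exact (congrArg Subtype.val happly).symm

/-- The edges on non-backtracking walks of length at most `t` from `(g, false)`. -/
def nearEdges (t : ℕ) : Set (CayleyEdge C D) :=
  {e | ∃ c w, (c :: w).IsChain (· ≠ ·) ∧ (c :: w).length ≤ t ∧ incidentEdge c (walkEnd g w) = e}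

theorem isPseudoforest_nearEdges : IsPseudoforest fun e : nearEdges g D => cayleyEnds e.1 := by
  choose c w hw hl he using fun e : nearEdges g D => e.2
  refine ⟨fun e => !(walkEnd g (w e)).2, fun e e' h => ?_⟩
  have hfar (e) : cayleyEnds e.1 (!(walkEnd g (w e)).2) = walkEnd g (c e :: w e) := by
    rw [← he e]
    exact cayleyEnds_incidentEdge_not _ _
  simp only [hfar] at h
  obtain ⟨hc, hw⟩ := List.cons.inj (injOn_walkEnd g ⟨hw e, hl e⟩ ⟨hw e', hl e'⟩ h)
  rw [Subtype.ext_iff, ← he e, ← he e', hc, hw]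

variable {g} {t : ℕ}

theorem exists_walkEnd_of_mem_nearEdges {e : CayleyEdge C D}
    (he : e ∈ nearEdges g t) (b : Bool) :
    ∃ w : List C, w.IsChain (· ≠ ·) ∧ w.length ≤ t ∧ walkEnd g w = cayleyEnds e b := by
  obtain ⟨c, w, hw, hl, rfl⟩ := he
  obtain rfl | hb := eq_or_ne b (walkEnd g w).2
  · exact ⟨w, hw.tail, (Nat.le_succ _).trans hl, (cayleyEnds_incidentEdge _ _).symm⟩
  · obtain rfl := Bool.eq_not.2 hb
    exact ⟨c :: w, hw, hl, (cayleyEnds_incidentEdge_not _ _).symm⟩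

theorem incidentEdge_walkEnd_mem_nearEdges (c : C) {w : List C} (hw : w.IsChain (· ≠ ·))
    (hl : w.length ≤ t) : incidentEdge c (walkEnd g w) ∈ nearEdges g (t + 1) := by
  by_cases h : w.head? = some c
  · obtain ⟨w, rfl⟩ := List.head?_eq_some_iff.1 h
    exact ⟨c, w, hw, hl.trans t.le_succ, (incidentEdge_neighbor _ _).symm⟩
  · exact ⟨c, w, isChain_ne_cons_iff.2 ⟨h, hw⟩, Nat.succ_le_succ hl, rfl⟩

theorem reach_shareEnd_subset_nearEdges (c : C) :
    reach (ShareEnd cayleyEnds) (g, c) t ⊆ nearEdges g (t + 1) := by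
  induction t with
  | zero => exact fun e he => ⟨c, [], .singleton c, le_rfl, Eq.symm he⟩
  | succ t ih =>
    rintro e' ⟨e, he, b, b', heq⟩
    obtain ⟨w, hw, hl, hend⟩ := exists_walkEnd_of_mem_nearEdges (ih he) b
    rw [← incidentEdge_cayleyEnds e' b', ← heq, ← hend]
    exact incidentEdge_walkEnd_mem_nearEdges _ hw hl

end Cayley

theorem exists_regular_locally_isPseudoforest {d : ℕ} (hd : 0 < d) (t : ℕ) :
    ∃ (U E : Type) (_ : Fintype U) (_ : Fintype E) (_ : Nonempty E) (ends : E → Bool → U),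
      MaxDegreeLE ends d ∧ d * Fintype.card U = 2 * Fintype.card E ∧
        ∀ e, IsPseudoforest fun e' : reach (ShareEnd ends) e t => ends e' := by
  have : NeZero d := ⟨hd.ne'⟩
  classical
  refine ⟨CayleyVertex (Fin d) (t + 1), CayleyEdge (Fin d) (t + 1), inferInstance, inferInstance,
    inferInstance, cayleyEnds, ?_, ?_, fun e => ?_⟩
  · simpa only [Nat.card_fin] using maxDegreeLE_cayleyEnds (C := Fin d) (D := t + 1)
  · simp only [Fintype.card_prod, Fintype.card_bool, Fintype.card_fin]
    ring
  · exact (isPseudoforest_nearEdges e.1).mono (reach_shareEnd_subset_nearEdges e.2)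

/-! ### Lower bounds on the approximation ratio -/

theorem IsLocalApproximation.mono {A : LocalRule} {r : ℕ} {α : ℝ} {F F' : Set MaxMinLP}
    (hA : IsLocalApproximation A r α F') (hF : F ⊆ F') : IsLocalApproximation A r α F :=
  ⟨hA.1, fun L hL => hA.2 L (hF hL)⟩

theorem inv_le_of_div_le_coe {o : EReal} {α y : ℝ} (hα : 0 ≤ α) (ho : 1 ≤ o)
    (h : o / (α : EReal) ≤ y) : α⁻¹ ≤ y := by
  rw [← EReal.coe_le_coe_iff, EReal.coe_inv]
  calc (α : EReal)⁻¹
    _ = 1 / α := (one_div _).symm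
    _ ≤ o / α := EReal.div_le_div_right_of_nonneg (EReal.coe_nonneg.2 hα) ho
    _ ≤ y := h

theorem div_le_of_isLocalApproximation {d n : ℕ} (hd : 0 < d) {F : Set MaxMinLP}
    (hF : ∀ (U E : Type) [Fintype U] [Fintype E] (ends : E → Bool → U), MaxDegreeLE ends d →
      subdivision ends n ∈ F)
    {A : LocalRule} {r : ℕ} {α : ℝ} (hA : IsLocalApproximation A r α F) :
    (d * n + d) / (d * n + 2) ≤ α := by
  classical
  obtain ⟨U, E, _, _, _, ends, hdeg, hcard, hforest⟩ :=
    exists_regular_locally_isPseudoforest hd (1 + (r + 2))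
  obtain ⟨ident, hident⟩ := Countable.exists_injective_nat (subdivision ends n).Node
  obtain ⟨hfeasible, -⟩ := hA.2 _ (hF U E ends hdeg) (.ofIdent ⟨ident, hident⟩)
  obtain ⟨⟨e, j⟩, hk⟩ := exists_objValue_subdivision_le hd hcard hfeasible
  let φ := restrictEmbedding ends n (reach (ShareEnd ends) e (1 + (r + 2)))
  have hmem : .obj (e, j) ∈ (subdivision ends n).ball (.agent (e, ⟨2 * j, by lia⟩)) 1 :=
    mem_ball_succ.2 ⟨_, mem_ball_zero.2 rfl, Or.inr (subdivObj_eq_iff.2 ⟨rfl, Or.inl rfl⟩)⟩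
  have hball : (subdivision ends n).ball (.obj (e, j)) (r + 2) ⊆ Set.range φ.onNode :=
    (ball_add_subset_ball_add hmem).trans (ball_agent_subset_range subset_rfl)
  have happrox := φ.opt_div_le_objValue_output ⟨ident, hident⟩ hA
    (hF _ _ _ (hdeg.restrict _)) (k := (⟨e, mem_reach_self _⟩, j)) hball
  have hα : 0 < α := zero_lt_one.trans_le hA.1
  have hinv := (inv_le_of_div_le_coe hα.le (one_le_opt_subdivision (hforest e)) happrox).trans hk
  rw [← inv_div]
  exact inv_le_of_inv_le₀ hα hinv

theorem exists_forall_div_le {d n ΔI ΔK : ℕ} (hd : 2 ≤ d) (hI : d ≤ ΔI) (hK : 2 ≤ ΔK) {δ : ℝ}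
    (hδ : (d - 2) / (2 * n + 2) < δ) :
    ∃ R : ℕ, ∀ (A : LocalRule) (r : ℕ) (α : ℝ),
      IsLocalApproximation A r α
        {L | L.DegreeBounded ΔI ΔK ∧ L.IsBipartite ∧ L.PositiveCoefficients ∧
          L.BoundedRelativeGrowth δ R} →
      (d * n + d) / (d * n + 2) ≤ α := by
  obtain ⟨R, hR⟩ := exists_nat_ge (2 * (2 * d + 2 * n + 2) / (δ - (d - 2) / (2 * n + 2)))
  rw [div_le_iff₀' (sub_pos.2 hδ)] at hR
  refine ⟨R, fun A r α hA => div_le_of_isLocalApproximation (zero_lt_two.trans_le hd) ?_ hA⟩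
  exact fun U E _ _ ends hdeg => ⟨degreeBounded_subdivision hdeg hI (hd.trans hI) hK,
    isBipartite_ofMaps _ _, positiveCoefficients_ofMaps _ _,
    boundedRelativeGrowth_subdivision hd hdeg hR⟩

theorem exists_subdivision_length {δ : ℝ} (hδ : 0 < δ) (hδ' : δ ≤ 2 / 5) :
    ∃ n : ℕ, 1 / (2 * n + 2) < δ ∧ 1 + δ / 2 ≤ (3 * n + 3) / (3 * n + 2) := by
  set n := ⌊1 / (2 * δ)⌋₊
  have hle : n * (2 * δ) ≤ 1 := (le_div_iff₀ (by positivity)).1 (Nat.floor_le (by positivity))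
  have hlt : 1 < (n + 1) * (2 * δ) := (div_lt_iff₀ (by positivity)).1 (Nat.lt_floor_add_one _)
  refine ⟨n, ?_, ?_⟩
  · rw [div_lt_iff₀ (by positivity)]
    linarith
  · rw [le_div_iff₀ (by positivity)]
    suffices (3 * n + 2) * δ ≤ 2 by linarith
    obtain hn | hn := le_or_gt n 1
    · have hn' : (n : ℝ) ≤ 1 := Nat.cast_le_one.2 hn
      nlinarith
    · have hn' : (2 : ℝ) ≤ n := Nat.ofNat_le_cast.2 hn
      nlinarith

end MaxMinLP

theorem theorem3_general (ΔI ΔK : ℕ) (hI : 3 ≤ ΔI) (hK : 2 ≤ ΔK)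
    (δ : ℝ) (hδ : 0 < δ) (hδ' : δ ≤ 2 / 5) :
    (¬ ∃ (A : MaxMinLP.LocalRule) (r : ℕ) (α : ℝ), α < 1 + δ / 2 ∧
      MaxMinLP.IsLocalApproximation A r α {L | L.DegreeBounded ΔI ΔK}) ∧
    ∃ R : ℕ, ¬ ∃ (A : MaxMinLP.LocalRule) (r : ℕ) (α : ℝ), α < 1 + δ / 2 ∧
      MaxMinLP.IsLocalApproximation A r α
        {L | L.DegreeBounded ΔI ΔK ∧ L.IsBipartite ∧ L.PositiveCoefficients ∧
          L.BoundedRelativeGrowth δ R} := by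
  obtain ⟨n, hgrowth, hratio⟩ := MaxMinLP.exists_subdivision_length hδ hδ'
  obtain ⟨R, hR⟩ := MaxMinLP.exists_forall_div_le (d := 3) (n := n) (ΔK := ΔK) (δ := δ)
    (by norm_num) hI hK (lt_of_eq_of_lt (by norm_num) hgrowth)
  refine ⟨?_, R, ?_⟩
  · rintro ⟨A, r, α, hα, hA⟩
    exact hα.not_ge (hratio.trans (mod_cast hR A r α (hA.mono fun _ hL => hL.1)))
  · rintro ⟨A, r, α, hα, hA⟩
    exact hα.not_ge (hratio.trans (mod_cast hR A r α hA))

theorem theorem3 (ΔI ΔK : ℕ) (hI : 3 ≤ ΔI) (hK : 3 ≤ ΔK)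
    (δ : ℝ) (hδ : 0 < δ) (hδ' : δ < 1 / 10) :
    (¬ ∃ (A : MaxMinLP.LocalRule) (r : ℕ) (α : ℝ), α < 1 + δ / 2 ∧
      MaxMinLP.IsLocalApproximation A r α {L | L.DegreeBounded ΔI ΔK}) ∧
    ∃ R : ℕ, ¬ ∃ (A : MaxMinLP.LocalRule) (r : ℕ) (α : ℝ), α < 1 + δ / 2 ∧
      MaxMinLP.IsLocalApproximation A r α
        {L | L.DegreeBounded ΔI ΔK ∧ L.IsBipartite ∧ L.PositiveCoefficients ∧
          L.BoundedRelativeGrowth δ R} :=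
  theorem3_general ΔI ΔK hI (by lia) δ hδ (by linarith)
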